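/- **Corollary (Céa Type Lemma).** For every $d\in\mathbb{N}$ there is a continuous function $c\colon(1,\infty)\to(0,\infty)$, depending only on $d$, such that the following holds. Let $p\in(1,\infty)$, let $\Omega\subseteq\mathbb{R}^d$ be a bounded domain (a bounded, connected, non-empty open set), let $f\in W^{1,p}(\Omega)^*$ be a continuous linear functional, and let $U\subseteq W^{1,p}(\Omega)$ be a closed linear subspace on which Poincaré's inequality holds, i.e. there is a constant $c_{\mathrm P}>0$ with $$\|v\|_{L^p(\Omega)}\le c_{\mathrm P}\,\|\nabla v\|_{L^p(\Omega)^d}\qquad\text{for all } v\in U.$$ Define the $p$-Dirichlet energy $E\colon U\to\mathbb{R}$ and the natural distance $\rho_F^2\colon W^{1,p}(\Omega)\times W^{1,p}(\Omega)\to\mathbb{R}$ by $$E(v):=\frac1p\int_\Omega|\nabla v|^p\,\mathrm{d}x-\langle f,v\rangle,\qquad \rho_F^2(v,w):=\|F(\nabla v)-F(\nabla w)\|_{L^2(\Omega)^d}^2,\qquad F(a):=|a|^{\frac{p-2}{2}}a\quad(a\in\mathbb{R}^d),$$ where $F(0)=0$. Then $E$ has a unique minimizer $u^*\in U$ over $U$,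 and for every subset $M\subseteq U$ (for example, a set of neural-network realizations) and every $v\in M$, $$\rho_F^2(v,u^*)\le c(p)\,\Big(\delta(v)+\inf_{\tilde v\in M}\rho_F^2(\tilde v,u^*)\Big),\qquad \delta(v):=E(v)-\inf_{\tilde v\in M}E(\tilde v).$$ -/

import Mathlib

open MeasureTheory

noncomputable section

namespace PDirichlet

/-- The space `ℝ^d` with its Euclidean norm. -/
abbrev Space (d : ℕ) : Type := EuclideanSpace ℝ (Fin d)

instance fact_one_le_ofReal (p : ℝ) [hp : Fact (1 < p)] : Fact (1 ≤ ENNReal.ofReal p) :=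
  ⟨by rw [ENNReal.one_le_ofReal]; exact hp.out.le⟩

/-- The Banach space `L^p(Ω; G)` with respect to the Lebesgue measure on `Ω`. -/
abbrev LpSpace {d : ℕ} (G : Type) [NormedAddCommGroup G] (p : ℝ) (Ω : Set (Space d)) : Type :=
  Lp G (ENNReal.ofReal p) (volume.restrict Ω)

/-- Test functions `φ ∈ C_c^∞(Ω)`, extended by zero to `ℝ^d`. -/
structure IsTestFunction {d : ℕ} (Ω : Set (Space d)) (φ : Space d → ℝ) : Prop where
  contDiff : ContDiff ℝ (⊤ : ℕ∞) φ
  hasCompactSupport : HasCompactSupport φ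
  tsupport_subset : tsupport φ ⊆ Ω

/-- The `i`-th partial derivative. -/
def partialDeriv {d : ℕ} (i : Fin d) (φ : Space d → ℝ) (x : Space d) : ℝ :=
  fderiv ℝ φ x (EuclideanSpace.single i 1)

/-- `g` is the distributional gradient of `u` in `Ω`:
`∫_Ω u ∂ᵢφ dx = - ∫_Ω gᵢ φ dx` for all `φ ∈ C_c^∞(Ω)` and all `i`. -/
def IsWeakGradient {d : ℕ} (Ω : Set (Space d)) (u : Space d → ℝ) (g : Space d → Space d) : Prop :=
  ∀ φ : Space d → ℝ, IsTestFunction Ω φ → ∀ i : Fin d,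
    ∫ x in Ω, u x * partialDeriv i φ x = - ∫ x in Ω, g x i * φ x

theorem IsTestFunction.continuous_partialDeriv {d : ℕ} {Ω : Set (Space d)} {φ : Space d → ℝ}
    (hφ : IsTestFunction Ω φ) (i : Fin d) : Continuous (partialDeriv i φ) :=
  (hφ.contDiff.continuous_fderiv (by simp)).clm_apply continuous_const

theorem IsTestFunction.hasCompactSupport_partialDeriv {d : ℕ} {Ω : Set (Space d)}
    {φ : Space d → ℝ} (hφ : IsTestFunction Ω φ) (i : Fin d) :
    HasCompactSupport (partialDeriv i φ) :=
  hφ.hasCompactSupport.fderiv_apply ℝ (EuclideanSpace.single i 1)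

theorem integrable_mul_of_hasCompactSupport {d : ℕ} {Ω : Set (Space d)} {p : ℝ} [Fact (1 < p)]
    {u ψ : Space d → ℝ} (hu : MemLp u (ENNReal.ofReal p) (volume.restrict Ω))
    (hψ : Continuous ψ) (hψc : HasCompactSupport ψ) :
    Integrable (fun x => u x * ψ x) (volume.restrict Ω) := by
  have hl : LocallyIntegrable u (volume.restrict Ω) :=
    hu.locallyIntegrable (Fact.out : 1 ≤ ENNReal.ofReal p)
  simpa [mul_comm] using hl.integrable_smul_left_of_hasCompactSupport hψ hψc

theorem memLp_coord {d : ℕ} {Ω : Set (Space d)} {p : ℝ} (g : LpSpace (Space d) p Ω) (i : Fin d) :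
    MemLp (fun x => g x i) (ENNReal.ofReal p) (volume.restrict Ω) :=
  (Lp.memLp g).continuousLinearMap_comp (EuclideanSpace.proj (𝕜 := ℝ) i)

/-- The Sobolev space `W^{1,p}(Ω)`. An element is a function in `L^p(Ω)` together with its
distributional gradient in `L^p(Ω)^d` (which the function determines, see `W1p.ext_fn`). The norm,
inherited from the `ℓ¹`-product, is `‖v‖_{L^p(Ω)} + ‖∇v‖_{L^p(Ω)^d}`. -/
def W1p {d : ℕ} (Ω : Set (Space d)) (p : ℝ) [Fact (1 < p)] :
    Submodule ℝ (WithLp 1 (LpSpace ℝ p Ω × LpSpace (Space d) p Ω)) where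
  carrier := {v | IsWeakGradient Ω v.fst v.snd}
  zero_mem' := by
    intro φ _ i
    have h1 : ∫ x in Ω, (0 : LpSpace ℝ p Ω) x * partialDeriv i φ x = 0 := by
      rw [integral_congr_ae (g := fun _ => (0 : ℝ)), integral_zero]
      filter_upwards [Lp.coeFn_zero ℝ (ENNReal.ofReal p) (volume.restrict Ω)] with x hx
      rw [hx]; simp
    have h2 : ∫ x in Ω, (0 : LpSpace (Space d) p Ω) x i * φ x = 0 := by
      rw [integral_congr_ae (g := fun _ => (0 : ℝ)), integral_zero]
      filter_upwards [Lp.coeFn_zero (Space d) (ENNReal.ofReal p) (volume.restrict Ω)] with x hx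
      rw [hx]; simp
    simpa using h1.trans (neg_eq_zero.mpr h2).symm
  add_mem' := by
    intro v w hv hw φ hφ i
    have h1 : ∫ x in Ω, (v.fst + w.fst) x * partialDeriv i φ x =
        (∫ x in Ω, v.fst x * partialDeriv i φ x) + ∫ x in Ω, w.fst x * partialDeriv i φ x := by
      rw [← integral_add
        (integrable_mul_of_hasCompactSupport (Lp.memLp v.fst) (hφ.continuous_partialDeriv i)
          (hφ.hasCompactSupport_partialDeriv i))
        (integrable_mul_of_hasCompactSupport (Lp.memLp w.fst) (hφ.continuous_partialDeriv i)
          (hφ.hasCompactSupport_partialDeriv i))]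
      refine integral_congr_ae ?_
      filter_upwards [Lp.coeFn_add v.fst w.fst] with x hx
      rw [hx]; simp [add_mul]
    have h2 : ∫ x in Ω, (v.snd + w.snd) x i * φ x =
        (∫ x in Ω, v.snd x i * φ x) + ∫ x in Ω, w.snd x i * φ x := by
      rw [← integral_add
        (integrable_mul_of_hasCompactSupport (memLp_coord v.snd i) hφ.contDiff.continuous
          hφ.hasCompactSupport)
        (integrable_mul_of_hasCompactSupport (memLp_coord w.snd i) hφ.contDiff.continuous
          hφ.hasCompactSupport)]
      refine integral_congr_ae ?_
      filter_upwards [Lp.coeFn_add v.snd w.snd] with x hx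
      rw [hx]; simp [add_mul]
    have e1 := hv φ hφ i
    have e2 := hw φ hφ i
    change ∫ x in Ω, (v.fst + w.fst) x * partialDeriv i φ x =
      - ∫ x in Ω, (v.snd + w.snd) x i * φ x
    rw [h1, h2, e1, e2]
    ring
  smul_mem' := by
    intro a v hv φ hφ i
    have h1 : ∫ x in Ω, (a • v.fst) x * partialDeriv i φ x =
        a * ∫ x in Ω, v.fst x * partialDeriv i φ x := by
      rw [← integral_const_mul]
      refine integral_congr_ae ?_
      filter_upwards [Lp.coeFn_smul a v.fst] with x hx
      rw [hx]; simp [mul_assoc]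
    have h2 : ∫ x in Ω, (a • v.snd) x i * φ x = a * ∫ x in Ω, v.snd x i * φ x := by
      rw [← integral_const_mul]
      refine integral_congr_ae ?_
      filter_upwards [Lp.coeFn_smul a v.snd] with x hx
      rw [hx]; simp [mul_assoc]
    have e1 := hv φ hφ i
    change ∫ x in Ω, (a • v.fst) x * partialDeriv i φ x = - ∫ x in Ω, (a • v.snd) x i * φ x
    rw [h1, h2, e1]
    ring

namespace W1p

variable {d : ℕ} {Ω : Set (Space d)} {p : ℝ} [Fact (1 < p)]

/-- The underlying function `v ∈ L^p(Ω)`. -/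
def fn (v : W1p Ω p) : LpSpace ℝ p Ω := (v : WithLp 1 (LpSpace ℝ p Ω × LpSpace (Space d) p Ω)).fst

/-- The gradient `∇v ∈ L^p(Ω)^d`. -/
def grad (v : W1p Ω p) : LpSpace (Space d) p Ω :=
  (v : WithLp 1 (LpSpace ℝ p Ω × LpSpace (Space d) p Ω)).snd

theorem norm_eq (v : W1p Ω p) : ‖v‖ = ‖fn v‖ + ‖grad v‖ :=
  WithLp.prod_norm_eq_of_L1 (v : WithLp 1 (LpSpace ℝ p Ω × LpSpace (Space d) p Ω))

/-- A Sobolev function is determined by its values in `L^p(Ω)`. -/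
theorem ext_fn (hΩ : IsOpen Ω) {v w : W1p Ω p} (h : fn v = fn w) : v = w := by
  have key : grad v = grad w := by
    apply Lp.ext
    have hi : ∀ i : Fin d, ∀ᵐ x ∂(volume : Measure (Space d)), x ∈ Ω →
        grad v x i - grad w x i = 0 := by
      intro i
      have hm : MemLp (fun x => grad v x i - grad w x i) (ENNReal.ofReal p)
          (volume.restrict Ω) := (memLp_coord (grad v) i).sub (memLp_coord (grad w) i)
      refine hΩ.ae_eq_zero_of_integral_contDiff_smul_eq_zero
        (locallyIntegrableOn_of_locallyIntegrable_restrict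
          (hm.locallyIntegrable (Fact.out : 1 ≤ ENNReal.ofReal p))) ?_
      intro φ hφ hφc hφs
      have ht : IsTestFunction Ω φ := ⟨hφ, hφc, hφs⟩
      have e1 := v.2 φ ht i
      have e2 := w.2 φ ht i
      change ∫ x in Ω, fn v x * partialDeriv i φ x = - ∫ x in Ω, grad v x i * φ x at e1
      change ∫ x in Ω, fn w x * partialDeriv i φ x = - ∫ x in Ω, grad w x i * φ x at e2
      have e3 : ∫ x in Ω, grad v x i * φ x = ∫ x in Ω, grad w x i * φ x := by
        rw [h] at e1; linarith
      have e4 : ∫ x in Ω, φ x • (grad v x i - grad w x i) = 0 := by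
        rw [← sub_eq_zero, ← integral_sub
          (integrable_mul_of_hasCompactSupport (memLp_coord (grad v) i) hφ.continuous hφc)
          (integrable_mul_of_hasCompactSupport (memLp_coord (grad w) i) hφ.continuous hφc)] at e3
        rw [← e3]
        congr 1
        ext x
        simp only [smul_eq_mul]
        ring
      rw [← e4]
      refine (setIntegral_eq_integral_of_forall_compl_eq_zero ?_).symm
      intro x hx
      have : φ x = 0 := image_eq_zero_of_notMem_tsupport (fun hx' => hx (hφs hx'))
      simp [this]
    have hall := ae_all_iff.mpr hi
    refine (ae_restrict_iff' hΩ.measurableSet).mpr ?_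
    filter_upwards [hall] with x hx hxΩ
    ext i
    exact sub_eq_zero.mp (hx i hxΩ)
  apply Subtype.ext
  exact (WithLp.ofLp_injective 1) (Prod.ext h key)

end W1p

/-- The map `F(a) = |a|^{(p-2)/2} a` on `ℝ^d`. -/
def natF {d : ℕ} (p : ℝ) (a : Space d) : Space d := ‖a‖ ^ ((p - 2) / 2) • a

/-- The natural distance `ρ_F²(v,w) = ‖F(∇v) - F(∇w)‖²_{L²(Ω)^d}`. -/
def rhoSq {d : ℕ} {Ω : Set (Space d)} {p : ℝ} [Fact (1 < p)] (v w : W1p Ω p) : ℝ :=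
  ∫ x in Ω, ‖natF p (W1p.grad v x) - natF p (W1p.grad w x)‖ ^ 2

/-- The `p`-Dirichlet energy `E(v) = (1/p) ∫_Ω |∇v|^p dx - ⟨f, v⟩`. -/
def energy {d : ℕ} {Ω : Set (Space d)} {p : ℝ} [Fact (1 < p)] (f : StrongDual ℝ (W1p Ω p))
    (v : W1p Ω p) : ℝ :=
  1 / p * (∫ x in Ω, ‖W1p.grad v x‖ ^ p) - f v

/-- `u` minimizes the `p`-Dirichlet energy over `U`. -/
def IsMinimizer {d : ℕ} {Ω : Set (Space d)} {p : ℝ} [Fact (1 < p)] (f : StrongDual ℝ (W1p Ω p))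
    (U : Submodule ℝ (W1p Ω p)) (u : W1p Ω p) : Prop :=
  u ∈ U ∧ ∀ w ∈ U, energy f u ≤ energy f w

/-- Poincaré's inequality `‖v‖_{L^p(Ω)} ≤ c_P ‖∇v‖_{L^p(Ω)^d}` on `U`. -/
def PoincareOn {d : ℕ} {Ω : Set (Space d)} {p : ℝ} [Fact (1 < p)]
    (U : Submodule ℝ (W1p Ω p)) : Prop :=
  ∃ cP : ℝ, 0 < cP ∧ ∀ v ∈ U, ‖W1p.fn v‖ ≤ cP * ‖W1p.grad v‖

/-- The optimization error `δ(v) = E(v) - inf_{w ∈ M} E(w)`. -/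
def optError {d : ℕ} {Ω : Set (Space d)} {p : ℝ} [Fact (1 < p)] (f : StrongDual ℝ (W1p Ω p))
    (M : Set (W1p Ω p)) (v : W1p Ω p) : ℝ :=
  energy f v - ⨅ w : M, energy f (w : W1p Ω p)

/-- The integrand of the natural distance is integrable, so `rhoSq` is the squared `L²`-norm. -/
theorem integrable_rhoSq {d : ℕ} {Ω : Set (Space d)} {p : ℝ} [hp : Fact (1 < p)] (v w : W1p Ω p) :
    Integrable (fun x => ‖natF p (W1p.grad v x) - natF p (W1p.grad w x)‖ ^ 2) (volume.restrict Ω) := by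
  have hp0 : (0 : ℝ) < p := zero_lt_one.trans hp.out
  have hmeas : Measurable (natF (d := d) p) := by
    unfold natF
    exact (measurable_norm.pow_const _).smul measurable_id
  have hn : ∀ a : Space d, ‖natF p a‖ ^ 2 = ‖a‖ ^ p := by
    intro a
    rcases eq_or_ne a 0 with rfl | ha
    · simp [natF, Real.zero_rpow hp0.ne']
    · have h0 : 0 < ‖a‖ := norm_pos_iff.mpr ha
      have h1 : ‖natF p a‖ = ‖a‖ ^ ((p - 2) / 2) * ‖a‖ := by
        rw [natF, norm_smul, Real.norm_of_nonneg (by positivity)]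
      rw [h1, mul_pow, ← Real.rpow_natCast (‖a‖ ^ _), ← Real.rpow_mul h0.le,
        ← Real.rpow_natCast ‖a‖, ← Real.rpow_add h0]
      congr 1
      push_cast
      ring
  have hF : ∀ z : W1p Ω p, MemLp (fun x => natF p (W1p.grad z x)) 2 (volume.restrict Ω) := by
    intro z
    have hae : AEStronglyMeasurable (fun x => natF p (W1p.grad z x)) (volume.restrict Ω) :=
      (hmeas.comp_aemeasurable (Lp.aestronglyMeasurable (W1p.grad z)).aemeasurable).aestronglyMeasurable
    rw [memLp_two_iff_integrable_sq_norm hae]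
    simp only [hn]
    have := (Lp.memLp (W1p.grad z)).integrable_norm_rpow (by simpa using hp0) ENNReal.ofReal_ne_top
    simpa [ENNReal.toReal_ofReal hp0.le] using this
  exact (memLp_two_iff_integrable_sq_norm ((hF v).sub (hF w)).1).mp ((hF v).sub (hF w))

end PDirichlet

end

noncomputable section

namespace PDirichlet

/-! ### Scalar power inequalities -/

/-! The proof uses only second differences `E(u+h) + E(u-h) - 2E(u)`, from which the linear
functional drops out, so neither a derivative of the energy nor an Euler–Lagrange equation is
needed. Pointwise, the second difference of `|a|^p` at `b` with increment `h` is comparable to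
`(|b|+|h|)^(p-2) |h|²` (`second_diff_le`, `le_second_diff`), and `|F(a)-F(b)|²` is comparable to
`max(|a|,|b|)^(p-2) |a-b|²` (`sq_norm_natF_sub_le`, `le_sq_norm_natF_sub`). After integration the
energy is uniformly convex and uniformly smooth with respect to `ρ_F²`.

If `u` minimizes over `U`, convexity at the midpoint of `v` and `u` gives `ρ_F²(v,u) ≤ C
(E(v)-E(u))`, and smoothness at `u`, with the reflected point `2u-v` in `U`, gives `E(v)-E(u) ≤ C
ρ_F²(v,u)`. Splitting `E(v)-E(u)` into `δ(v)` and `inf_M E - E(u)` and bounding the latter by the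
infimum of `ρ_F²` yields the estimate.

Existence and uniqueness also come from uniform convexity: by coercivity and Poincaré's inequality,
almost minimizers are close in norm, so minimizing sequences are Cauchy and weak compactness is not
used. -/

theorem rpow_tangent_le {q x y : ℝ} (hq : 1 ≤ q) (hx : 0 ≤ x) (hy : 0 ≤ y) :
    x ^ q + q * x ^ (q - 1) * (y - x) ≤ y ^ q := by
  rcases hx.eq_or_lt with rfl | hx
  -- At `x = 0` the slope is `0 ^ 0 = 1` for `q = 1` and `0` for `q > 1`; both are correct.
  · rcases hq.eq_or_lt with rfl | hq
    · simp
    · rw [Real.zero_rpow (by linarith), Real.zero_rpow (by linarith)]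
      simpa using Real.rpow_nonneg hy q
  · have h := one_add_mul_self_le_rpow_one_add (s := y / x - 1) (p := q)
      (by have := div_nonneg hy hx.le; linarith) hq
    rw [add_sub_cancel, Real.div_rpow hy hx.le, le_div_iff₀ (Real.rpow_pos_of_pos hx q)] at h
    have e : x ^ q = x ^ (q - 1) * x := by
      rw [← Real.rpow_add_one hx.ne', sub_add_cancel]
    calc _ = (1 + q * (y / x - 1)) * x ^ q := by rw [e]; field_simp
      _ ≤ _ := h

/-- Bernoulli's inequality for concave powers. Here `x = 0` must be excluded: for `0 < q < 1` the
convention `0 ^ (q - 1) = 0` would make the tangent vanish identically. -/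
theorem rpow_le_tangent {q x y : ℝ} (hq0 : 0 ≤ q) (hq : q ≤ 1) (hx : 0 < x) (hy : 0 ≤ y) :
    y ^ q ≤ x ^ q + q * x ^ (q - 1) * (y - x) := by
  have h := rpow_one_add_le_one_add_mul_self (s := y / x - 1) (p := q)
    (by have := div_nonneg hy hx.le; linarith) hq0 hq
  rw [add_sub_cancel, Real.div_rpow hy hx.le, div_le_iff₀ (Real.rpow_pos_of_pos hx q)] at h
  have e : x ^ q = x ^ (q - 1) * x := by
    rw [← Real.rpow_add_one hx.ne', sub_add_cancel]
  calc _ ≤ (1 + q * (y / x - 1)) * x ^ q := h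
    _ = _ := by rw [e]; field_simp

theorem rpow_eq_rpow_sub_one_mul {q x : ℝ} (hq : 0 < q) (hx : 0 ≤ x) :
    x ^ q = x ^ (q - 1) * x := by
  rcases hx.eq_or_lt with rfl | hx
  · simp [Real.zero_rpow hq.ne']
  · rw [← Real.rpow_add_one hx.ne', sub_add_cancel]

theorem rpow_eq_rpow_sub_two_mul {p x : ℝ} (hp : 0 < p) (hx : 0 ≤ x) :
    x ^ p = x ^ (p - 2) * x ^ 2 := by
  rcases hx.eq_or_lt with rfl | hx
  · simp [Real.zero_rpow hp.ne']
  · rw [← Real.rpow_add_natCast hx.ne']; congr 1; push_cast; ring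

/-- Powers of comparable numbers are comparable. -/
theorem rpow_sub_two_le_of_comparable {p x y : ℝ} (hp : 1 < p) (hx : 0 < x)
    (h1 : x ≤ 3 * y) (h2 : y ≤ 3 * x) : x ^ (p - 2) ≤ 3 ^ p * y ^ (p - 2) := by
  have hy : 0 < y := by linarith
  rcases le_total 2 p with h | h
  · calc x ^ (p - 2) ≤ (3 * y) ^ (p - 2) := Real.rpow_le_rpow hx.le h1 (by linarith)
      _ = 3 ^ (p - 2) * y ^ (p - 2) := Real.mul_rpow (by norm_num) hy.le
      _ ≤ _ := by
        gcongr
        · norm_num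
        · linarith
  · calc x ^ (p - 2) ≤ (3⁻¹ * y) ^ (p - 2) :=
          Real.rpow_le_rpow_of_nonpos (by positivity) (by linarith) (by linarith)
      _ = 3⁻¹ ^ (p - 2) * y ^ (p - 2) := Real.mul_rpow (by norm_num) hy.le
      _ = 3 ^ (2 - p) * y ^ (p - 2) := by
        rw [Real.inv_rpow (by norm_num), ← Real.rpow_neg (by norm_num), neg_sub]
      _ ≤ _ := by
        gcongr
        · norm_num
        · linarith

/-- Second differences of `x ^ p` for `2 ≤ p`. -/
theorem rpow_second_diff_le {p s t : ℝ} (hp : 2 ≤ p) (hs : 0 ≤ s) (ht : 0 ≤ t) :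
    (s + t) ^ p + |s - t| ^ p - 2 * s ^ p ≤ (8 + 2 * p ^ 2) * ((s + t) ^ (p - 2) * t ^ 2) := by
  have hX : 0 ≤ (s + t) ^ (p - 2) := by positivity
  have hXt : 0 ≤ (s + t) ^ (p - 2) * t ^ 2 := by positivity
  have hsp : 0 ≤ s ^ p := by positivity
  -- For `s ≤ t` each of the two powers is at most `4 (s+t)^(p-2) t²`, whence the `8`. For `t ≤ s`
  -- the tangents at `s ± t` leave `p t ((s+t)^(p-1) - (s-t)^(p-1))`, and the tangent of `x^(p-1)`
  -- at `s+t` gives `2p(p-1)`.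
  rcases le_total s t with h | h
  · have h1 : |s - t| ^ p ≤ (s + t) ^ p :=
      Real.rpow_le_rpow (abs_nonneg _) (abs_le.2 ⟨by linarith, by linarith⟩) (by linarith)
    have h2 : (s + t) ^ p ≤ 4 * ((s + t) ^ (p - 2) * t ^ 2) := by
      rw [rpow_eq_rpow_sub_two_mul (x := s + t) (by linarith) (by positivity)]
      have : (s + t) ^ 2 ≤ 4 * t ^ 2 := by nlinarith
      nlinarith
    nlinarith [mul_nonneg (sq_nonneg p) hXt]
  · rw [abs_of_nonneg (by linarith)]
    have h1 := rpow_tangent_le (q := p) (x := s + t) (y := s) (by linarith) (by positivity) hs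
    have h2 := rpow_tangent_le (q := p) (x := s - t) (y := s) (by linarith) (by linarith) hs
    have h3 := rpow_tangent_le (q := p - 1) (x := s + t) (y := s - t) (by linarith)
      (by positivity) (by linarith)
    have e : p - 1 - 1 = p - 2 := by ring
    rw [e] at h3
    have h4 : (s + t) ^ (p - 1) - (s - t) ^ (p - 1) ≤ (p - 1) * (s + t) ^ (p - 2) * (2 * t) := by
      linarith
    have h5 := mul_le_mul_of_nonneg_left h4 (mul_nonneg (by linarith : 0 ≤ p) ht)
    nlinarith

/-- Second differences of `x ^ p` for `1 < p ≤ 2`. -/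
theorem le_rpow_second_diff {p s t : ℝ} (hp1 : 1 < p) (hp : p ≤ 2) (hs : 0 ≤ s) (ht : 0 ≤ t) :
    p * (p - 1) / 4 * ((s + t) ^ (p - 2) * t ^ 2) ≤
      (s + t) ^ p + |s - t| ^ p - 2 * s ^ p := by
  rcases ht.eq_or_lt with rfl | ht
  · simp [abs_of_nonneg hs]; linarith
  -- A single tangent from `s` to `s + t` would give no quadratic gain. Stopping at `s + t/2` leaves
  -- `(p t/2) ((s+t/2)^(p-1) - s^(p-1))`, which concavity of `x^(p-1)` bounds below.
  have h1 := rpow_tangent_le (q := p) (x := s) (y := s + t / 2) hp1.le hs (by positivity)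
  have h2 := rpow_tangent_le (q := p) (x := s + t / 2) (y := s + t) hp1.le (by positivity)
    (by positivity)
  have h3 : s ^ p - p * s ^ (p - 1) * t ≤ |s - t| ^ p := by
    rcases le_total t s with h | h
    · rw [abs_of_nonneg (by linarith)]
      have := rpow_tangent_le (q := p) (x := s) (y := s - t) hp1.le hs (by linarith)
      linarith
    -- Since `s ≤ t ≤ p t`, the left side `s^(p-1) (s - p t)` is not positive.
    · have e := rpow_eq_rpow_sub_one_mul (q := p) (by linarith) hs
      have h0 : 0 ≤ s ^ (p - 1) := by positivity
      have h4 : 0 ≤ |s - t| ^ p := by positivity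
      rw [e]
      nlinarith [mul_nonneg h0 hs, mul_le_mul_of_nonneg_left h h0,
        mul_nonneg (by linarith : 0 ≤ p - 1) (mul_nonneg h0 ht.le)]
  have h4 := rpow_le_tangent (q := p - 1) (x := s + t / 2) (y := s) (by linarith) (by linarith)
    (by positivity) hs
  have e : p - 1 - 1 = p - 2 := by ring
  rw [e] at h4
  have h5 : (s + t) ^ (p - 2) ≤ (s + t / 2) ^ (p - 2) :=
    Real.rpow_le_rpow_of_nonpos (by positivity) (by linarith) (by linarith)
  have h6 : (p - 1) * (s + t / 2) ^ (p - 2) * (t / 2) ≤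
    (s + t / 2) ^ (p - 1) - s ^ (p - 1) := by linarith
  have h7 := mul_le_mul_of_nonneg_left h6 (by positivity : 0 ≤ p * (t / 2))
  have h8 := mul_le_mul_of_nonneg_left h5
    (mul_nonneg (by nlinarith) (by positivity) : 0 ≤ (p * (p - 1)) * (t ^ 2 / 4))
  nlinarith

/-! ### Second differences of `|a| ^ p` -/

theorem rpow_norm_eq_sq {W : Type*} [NormedAddCommGroup W] {p : ℝ} (a : W) : ‖a‖ ^ p = (‖a‖ ^ 2) ^ (p / 2) := by
  rw [← Real.rpow_natCast, ← Real.rpow_mul (norm_nonneg a)]; congr 1; push_cast; ring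

section Vector

variable {V : Type*} [NormedAddCommGroup V] [InnerProductSpace ℝ V]

theorem sq_norm_add_mem (b h : V) :
    ‖b + h‖ ^ 2 ∈ Set.Icc ((‖b‖ - ‖h‖) ^ 2) ((‖b‖ + ‖h‖) ^ 2) := by
  rw [norm_add_sq_real]
  have := abs_le.1 (abs_real_inner_le_norm b h)
  constructor <;> nlinarith

theorem sq_norm_add_add_sq_norm_sub (b h : V) :
    ‖b + h‖ ^ 2 + ‖b - h‖ ^ 2 = 2 * (‖b‖ ^ 2 + ‖h‖ ^ 2) := by
  rw [norm_add_sq_real, norm_sub_sq_real]; ring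

/-- Reduction to collinear vectors. By the parallelogram law, `‖b+h‖²` and `‖b-h‖²` are symmetric
about the midpoint of the interval with endpoints `(‖b‖ ∓ ‖h‖)²`, so they are convex combinations of
the endpoints with swapped weights; convexity of `x^(p/2)` then applies. -/
theorem rpow_add_rpow_le_of_two_le {p : ℝ} (hp : 2 ≤ p) (b h : V) :
    ‖b + h‖ ^ p + ‖b - h‖ ^ p ≤ (‖b‖ + ‖h‖) ^ p + |‖b‖ - ‖h‖| ^ p := by
  have hm := sq_norm_add_mem b h
  rw [← segment_eq_Icc (hm.1.trans hm.2)] at hm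
  obtain ⟨α, β, hα, hβ, hab, e⟩ := hm
  have e' : β • (‖b‖ - ‖h‖) ^ 2 + α • (‖b‖ + ‖h‖) ^ 2 = ‖b - h‖ ^ 2 := by
    have := sq_norm_add_add_sq_norm_sub b h
    have hβ' : β = 1 - α := by linarith
    subst hβ'
    simp only [smul_eq_mul] at e ⊢
    linear_combination -this - e
  have hc := (convexOn_rpow (p := p / 2) (by linarith)).2
  have h1 := hc (x := (‖b‖ - ‖h‖) ^ 2) (Set.mem_Ici.2 (sq_nonneg _))
    (y := (‖b‖ + ‖h‖) ^ 2) (Set.mem_Ici.2 (sq_nonneg _)) hα hβ hab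
  have h2 := hc (x := (‖b‖ - ‖h‖) ^ 2) (Set.mem_Ici.2 (sq_nonneg _))
    (y := (‖b‖ + ‖h‖) ^ 2) (Set.mem_Ici.2 (sq_nonneg _)) hβ hα (by linarith)
  simp only [e, e'] at h1 h2
  rw [rpow_norm_eq_sq, rpow_norm_eq_sq (b - h), ← Real.norm_of_nonneg
    (by positivity : 0 ≤ ‖b‖ + ‖h‖), ← Real.norm_eq_abs, rpow_norm_eq_sq (‖b‖ + ‖h‖),
    rpow_norm_eq_sq (‖b‖ - ‖h‖)]
  simp only [Real.norm_eq_abs, sq_abs, smul_eq_mul] at h1 h2 ⊢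
  have hβ' : β = 1 - α := by linarith
  subst hβ'
  linarith

theorem le_rpow_add_rpow_of_le_two {p : ℝ} (hp0 : 0 ≤ p) (hp : p ≤ 2) (b h : V) :
    (‖b‖ + ‖h‖) ^ p + |‖b‖ - ‖h‖| ^ p ≤ ‖b + h‖ ^ p + ‖b - h‖ ^ p := by
  have hm := sq_norm_add_mem b h
  rw [← segment_eq_Icc (hm.1.trans hm.2)] at hm
  obtain ⟨α, β, hα, hβ, hab, e⟩ := hm
  have e' : β • (‖b‖ - ‖h‖) ^ 2 + α • (‖b‖ + ‖h‖) ^ 2 = ‖b - h‖ ^ 2 := by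
    have := sq_norm_add_add_sq_norm_sub b h
    have hβ' : β = 1 - α := by linarith
    subst hβ'
    simp only [smul_eq_mul] at e ⊢
    linear_combination -this - e
  have hc := (Real.concaveOn_rpow (p := p / 2) (by linarith) (by linarith)).2
  have h1 := hc (x := (‖b‖ - ‖h‖) ^ 2) (Set.mem_Ici.2 (sq_nonneg _))
    (y := (‖b‖ + ‖h‖) ^ 2) (Set.mem_Ici.2 (sq_nonneg _)) hα hβ hab
  have h2 := hc (x := (‖b‖ - ‖h‖) ^ 2) (Set.mem_Ici.2 (sq_nonneg _))
    (y := (‖b‖ + ‖h‖) ^ 2) (Set.mem_Ici.2 (sq_nonneg _)) hβ hα (by linarith)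
  simp only [e, e'] at h1 h2
  rw [rpow_norm_eq_sq (b + h), rpow_norm_eq_sq (b - h), ← Real.norm_of_nonneg
    (by positivity : 0 ≤ ‖b‖ + ‖h‖), ← Real.norm_eq_abs, rpow_norm_eq_sq (‖b‖ + ‖h‖),
    rpow_norm_eq_sq (‖b‖ - ‖h‖)]
  simp only [Real.norm_eq_abs, sq_abs, smul_eq_mul] at h1 h2 ⊢
  have hβ' : β = 1 - α := by linarith
  subst hβ'
  linarith

theorem rpow_half_sub_one_sum_sq {p x y : ℝ} (hx : 0 ≤ x) (hy : 0 ≤ y) :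
    ((x + y) ^ 2) ^ (p / 2 - 1) = (x + y) ^ (p - 2) := by
  rw [← Real.rpow_natCast, ← Real.rpow_mul (by positivity)]; congr 1; push_cast; ring

/-- Upper bound for second differences of `|a| ^ p`. -/
theorem second_diff_le {p : ℝ} (hp : 1 < p) (b h : V) :
    ‖b + h‖ ^ p + ‖b - h‖ ^ p - 2 * ‖b‖ ^ p ≤
      (8 + 2 * p ^ 2) * ((‖b‖ + ‖h‖) ^ (p - 2) * ‖h‖ ^ 2) := by
  rcases le_total 2 p with h2 | h2
  · have h3 := rpow_add_rpow_le_of_two_le h2 b h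
    have h4 := rpow_second_diff_le h2 (norm_nonneg b) (norm_nonneg h)
    linarith
  · rcases eq_or_ne h 0 with rfl | hh
    · simp; linarith
    have hη : 0 < ‖h‖ := norm_pos_iff.2 hh
    have hm : 0 < ‖b‖ ^ 2 + ‖h‖ ^ 2 := by positivity
    -- Both tangents are taken at the mean of `‖b+h‖²` and `‖b-h‖²`, so the linear terms cancel in
    -- the sum. The case `h = 0` was split off to make this mean positive.
    have t1 := rpow_le_tangent (q := p / 2) (x := ‖b‖ ^ 2 + ‖h‖ ^ 2) (y := ‖b + h‖ ^ 2)
      (by linarith) (by linarith) hm (by positivity)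
    have t2 := rpow_le_tangent (q := p / 2) (x := ‖b‖ ^ 2 + ‖h‖ ^ 2) (y := ‖b - h‖ ^ 2)
      (by linarith) (by linarith) hm (by positivity)
    rw [← rpow_norm_eq_sq] at t1 t2
    have e := sq_norm_add_add_sq_norm_sub b h
    have t3 : ‖b + h‖ ^ p + ‖b - h‖ ^ p ≤ 2 * (‖b‖ ^ 2 + ‖h‖ ^ 2) ^ (p / 2) := by
      have : ‖b - h‖ ^ 2 = 2 * (‖b‖ ^ 2 + ‖h‖ ^ 2) - ‖b + h‖ ^ 2 := by linarith
      rw [this] at t2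
      linarith
    set m := ‖b‖ ^ 2 + ‖h‖ ^ 2
    have t4 : m ^ (p / 2 - 1) * ‖b‖ ^ 2 ≤ ‖b‖ ^ p := by
      rcases (norm_nonneg b).eq_or_lt with h0 | h0
      · rw [← h0]; simp; positivity
      · rw [rpow_norm_eq_sq, rpow_eq_rpow_sub_one_mul (q := p / 2) (by linarith) (sq_nonneg ‖b‖)]
        refine mul_le_mul_of_nonneg_right ?_ (sq_nonneg _)
        exact Real.rpow_le_rpow_of_nonpos (by positivity) (by simp [m]) (by linarith)
    have t5 := rpow_eq_rpow_sub_one_mul (q := p / 2) (by linarith) hm.le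
    have t6 : m ^ (p / 2 - 1) ≤ 2 * (‖b‖ + ‖h‖) ^ (p - 2) := by
      calc m ^ (p / 2 - 1) ≤ (2⁻¹ * (‖b‖ + ‖h‖) ^ 2) ^ (p / 2 - 1) := by
            refine Real.rpow_le_rpow_of_nonpos (by positivity) ?_ (by linarith)
            simp only [m]; nlinarith [sq_nonneg (‖b‖ - ‖h‖)]
        _ = 2⁻¹ ^ (p / 2 - 1) * (‖b‖ + ‖h‖) ^ (p - 2) := by
            rw [Real.mul_rpow (by norm_num) (sq_nonneg _),
              rpow_half_sub_one_sum_sq (norm_nonneg b) (norm_nonneg h)]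
        _ ≤ _ := by
            refine mul_le_mul_of_nonneg_right ?_ (by positivity)
            rw [Real.inv_rpow (by norm_num), ← Real.rpow_neg (by norm_num)]
            calc (2 : ℝ) ^ (-(p / 2 - 1)) ≤ 2 ^ (1 : ℝ) :=
                  Real.rpow_le_rpow_of_exponent_le (by norm_num) (by linarith)
              _ = 2 := Real.rpow_one 2
    have t7 : m ^ (p / 2) - ‖b‖ ^ p ≤ m ^ (p / 2 - 1) * ‖h‖ ^ 2 := by
      rw [t5]
      have : m ^ (p / 2 - 1) * m = m ^ (p / 2 - 1) * ‖b‖ ^ 2 + m ^ (p / 2 - 1) * ‖h‖ ^ 2 := by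
        simp only [m]; ring
      linarith
    have t8 := mul_le_mul_of_nonneg_right t6 (sq_nonneg ‖h‖)
    have t9 : 0 ≤ (‖b‖ + ‖h‖) ^ (p - 2) * ‖h‖ ^ 2 := by positivity
    nlinarith [mul_nonneg (sq_nonneg p) t9]

/-- The constant in the lower bound for second differences of `|a| ^ p`. -/
def convexityConst (p : ℝ) : ℝ := min ((1 / 2) ^ p) (p * (p - 1) / 4)

theorem convexityConst_pos {p : ℝ} (hp : 1 < p) : 0 < convexityConst p :=
  lt_min (by positivity) (by have := sub_pos.2 hp; positivity)

theorem continuous_convexityConst : Continuous convexityConst := by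
  unfold convexityConst
  have : Continuous fun p : ℝ => (1 / 2 : ℝ) ^ p :=
    continuous_const.rpow continuous_id fun _ => Or.inl (by norm_num)
  fun_prop

/-- Lower bound for second differences of `|a| ^ p`. -/
theorem le_second_diff {p : ℝ} (hp : 1 < p) (b h : V) :
    convexityConst p * ((‖b‖ + ‖h‖) ^ (p - 2) * ‖h‖ ^ 2) ≤
      ‖b + h‖ ^ p + ‖b - h‖ ^ p - 2 * ‖b‖ ^ p := by
  have h9 : 0 ≤ (‖b‖ + ‖h‖) ^ (p - 2) * ‖h‖ ^ 2 := by positivity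
  -- The roles are exchanged compared with `second_diff_le`: for `p ≤ 2` the collinear case is
  -- extremal, giving `p (p - 1) / 4`; for `p ≥ 2` the tangent of the convex `x^(p/2)` at the mean
  -- gives `(1 / 2) ^ p`.
  rcases le_total p 2 with h2 | h2
  · have h3 := le_rpow_add_rpow_of_le_two (by linarith) h2 b h
    have h4 := le_rpow_second_diff hp h2 (norm_nonneg b) (norm_nonneg h)
    have h5 := mul_le_mul_of_nonneg_right (min_le_right ((1 / 2) ^ p) (p * (p - 1) / 4)) h9
    unfold convexityConst
    linarith
  · have hm : 0 ≤ ‖b‖ ^ 2 + ‖h‖ ^ 2 := by positivity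
    have t1 := rpow_tangent_le (q := p / 2) (x := ‖b‖ ^ 2 + ‖h‖ ^ 2) (y := ‖b + h‖ ^ 2)
      (by linarith) hm (by positivity)
    have t2 := rpow_tangent_le (q := p / 2) (x := ‖b‖ ^ 2 + ‖h‖ ^ 2) (y := ‖b - h‖ ^ 2)
      (by linarith) hm (by positivity)
    rw [← rpow_norm_eq_sq] at t1 t2
    have e := sq_norm_add_add_sq_norm_sub b h
    have t3 : 2 * (‖b‖ ^ 2 + ‖h‖ ^ 2) ^ (p / 2) ≤ ‖b + h‖ ^ p + ‖b - h‖ ^ p := by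
      have : ‖b - h‖ ^ 2 = 2 * (‖b‖ ^ 2 + ‖h‖ ^ 2) - ‖b + h‖ ^ 2 := by linarith
      rw [this] at t2
      linarith
    set m := ‖b‖ ^ 2 + ‖h‖ ^ 2
    have t4 : ‖b‖ ^ p ≤ m ^ (p / 2 - 1) * ‖b‖ ^ 2 := by
      rw [rpow_norm_eq_sq, rpow_eq_rpow_sub_one_mul (q := p / 2) (by linarith) (sq_nonneg ‖b‖)]
      refine mul_le_mul_of_nonneg_right ?_ (sq_nonneg _)
      exact Real.rpow_le_rpow (by positivity) (by simp [m]) (by linarith)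
    have t5 := rpow_eq_rpow_sub_one_mul (q := p / 2) (by linarith) hm
    have t6 : (1 / 2) ^ p * (‖b‖ + ‖h‖) ^ (p - 2) ≤ m ^ (p / 2 - 1) := by
      calc _ ≤ 2⁻¹ ^ (p / 2 - 1) * (‖b‖ + ‖h‖) ^ (p - 2) := by
            refine mul_le_mul_of_nonneg_right ?_ (by positivity)
            rw [one_div]
            exact Real.rpow_le_rpow_of_exponent_ge (by norm_num) (by norm_num) (by linarith)
        _ = (2⁻¹ * (‖b‖ + ‖h‖) ^ 2) ^ (p / 2 - 1) := by
            rw [Real.mul_rpow (by norm_num) (sq_nonneg _),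
              rpow_half_sub_one_sum_sq (norm_nonneg b) (norm_nonneg h)]
        _ ≤ _ := by
            refine Real.rpow_le_rpow (by positivity) ?_ (by linarith)
            simp only [m]; nlinarith [sq_nonneg (‖b‖ - ‖h‖)]
    have t7 : m ^ (p / 2 - 1) * ‖h‖ ^ 2 ≤ m ^ (p / 2) - ‖b‖ ^ p := by
      rw [t5]
      have : m ^ (p / 2 - 1) * m = m ^ (p / 2 - 1) * ‖b‖ ^ 2 + m ^ (p / 2 - 1) * ‖h‖ ^ 2 := by
        simp only [m]; ring
      linarith
    have t8 := mul_le_mul_of_nonneg_right t6 (sq_nonneg ‖h‖)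
    have h5 := mul_le_mul_of_nonneg_right (min_le_left ((1 / 2) ^ p) (p * (p - 1) / 4)) h9
    have h6 : 0 ≤ (1 / 2) ^ p * ((‖b‖ + ‖h‖) ^ (p - 2) * ‖h‖ ^ 2) := by positivity
    unfold convexityConst
    linarith

end Vector

/-! ### Estimates for the map `F` -/

section NatF

variable {d : ℕ} {p : ℝ}

/-- The square splits into a radial part and a multiple of the angular defect `‖a‖ * ‖b‖ - inner ℝ a
b`. Since `sq_norm_sub_eq` splits `‖a - b‖ ^ 2` likewise, comparing the two becomes a scalar
problem. -/
theorem sq_norm_natF_sub (a b : Space d) :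
    ‖natF p a - natF p b‖ ^ 2 =
      (‖a‖ ^ ((p - 2) / 2) * ‖a‖ - ‖b‖ ^ ((p - 2) / 2) * ‖b‖) ^ 2 +
        2 * (‖a‖ ^ ((p - 2) / 2) * ‖b‖ ^ ((p - 2) / 2)) * (‖a‖ * ‖b‖ - inner ℝ a b) := by
  rw [norm_sub_sq_real, natF, natF, norm_smul, norm_smul, real_inner_smul_left,
    real_inner_smul_right, Real.norm_of_nonneg (by positivity), Real.norm_of_nonneg (by positivity)]
  ring

theorem sq_norm_sub_eq (a b : Space d) :
    ‖a - b‖ ^ 2 = (‖a‖ - ‖b‖) ^ 2 + 2 * (‖a‖ * ‖b‖ - inner ℝ a b) := by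
  rw [norm_sub_sq_real]; ring

theorem sq_norm_natF_sub_le_of_norm_le (hp : 1 < p) {a b : Space d} (hab : ‖b‖ ≤ ‖a‖) :
    ‖natF p a - natF p b‖ ^ 2 ≤ (16 + p ^ 2) * (‖a‖ ^ (p - 2) * ‖a - b‖ ^ 2) := by
  rcases (norm_nonneg a).eq_or_lt with h0 | h0
  · have ha : a = 0 := norm_eq_zero.1 h0.symm
    have hb : b = 0 := norm_eq_zero.1 (le_antisymm (h0.symm ▸ hab) (norm_nonneg b))
    simp [ha, hb]
  rw [sq_norm_natF_sub, sq_norm_sub_eq]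
  have hω1 : 0 ≤ ‖a‖ * ‖b‖ - inner ℝ a b := sub_nonneg.2 (real_inner_le_norm a b)
  have hω2 : ‖a‖ * ‖b‖ - inner ℝ a b ≤ 2 * (‖a‖ * ‖b‖) := by
    linarith [(abs_le.1 (abs_real_inner_le_norm a b)).1]
  have eα : ‖a‖ ^ (p - 2) = (‖a‖ ^ ((p - 2) / 2)) ^ 2 := by
    rw [← Real.rpow_natCast, ← Real.rpow_mul h0.le]; congr 1; push_cast; ring
  have ea := rpow_eq_rpow_sub_one_mul (q := p / 2) (by linarith) (norm_nonneg a)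
  have eb := rpow_eq_rpow_sub_one_mul (q := p / 2) (by linarith) (norm_nonneg b)
  have ek : p / 2 - 1 = (p - 2) / 2 := by ring
  rw [ek] at ea eb
  rw [eα]
  have hs := norm_nonneg b
  have hα : 0 < ‖a‖ ^ ((p - 2) / 2) := by positivity
  have hβ : 0 ≤ ‖b‖ ^ ((p - 2) / 2) := by positivity
  generalize hωd : ‖a‖ * ‖b‖ - inner ℝ a b = ω at *
  have mono : ‖b‖ ^ (p / 2) ≤ ‖a‖ ^ (p / 2) := Real.rpow_le_rpow hs hab (by linarith)
  rw [ea, eb] at mono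
  rcases le_total 2 p with h2 | h2
  · have t := rpow_tangent_le (q := p / 2) (x := ‖a‖) (y := ‖b‖) (by linarith) h0.le hs
    rw [ek, ea, eb] at t
    have hβα : ‖b‖ ^ ((p - 2) / 2) ≤ ‖a‖ ^ ((p - 2) / 2) := Real.rpow_le_rpow hs hab (by linarith)
    generalize ‖a‖ ^ ((p - 2) / 2) = α at *
    generalize ‖b‖ ^ ((p - 2) / 2) = β at *
    generalize ‖a‖ = r at *
    generalize ‖b‖ = s at *
    have t1 : α * r - β * s ≤ p / 2 * (α * (r - s)) := by linarith
    have t2 : (α * r - β * s) ^ 2 ≤ (p / 2 * (α * (r - s))) ^ 2 :=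
      pow_le_pow_left₀ (by linarith) t1 2
    have t3 : α * β * ω ≤ α ^ 2 * ω := by
      rw [sq]; gcongr
    have t4 : 0 ≤ α ^ 2 * (r - s) ^ 2 := by positivity
    have t5 : 0 ≤ α ^ 2 * ω := by positivity
    nlinarith [mul_nonneg (sq_nonneg p) t4, mul_nonneg (sq_nonneg p) t5]
  · rcases le_total ‖a‖ (2 * ‖b‖) with hc | hc
    · have hb0 : 0 < ‖b‖ := by linarith
      have hβα : ‖a‖ ^ ((p - 2) / 2) ≤ ‖b‖ ^ ((p - 2) / 2) :=
        Real.rpow_le_rpow_of_nonpos hb0 hab (by linarith)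
      have hβ2 : ‖b‖ ^ ((p - 2) / 2) ≤ 2 * ‖a‖ ^ ((p - 2) / 2) := by
        calc ‖b‖ ^ ((p - 2) / 2) ≤ (2⁻¹ * ‖a‖) ^ ((p - 2) / 2) :=
              Real.rpow_le_rpow_of_nonpos (by positivity) (by linarith) (by linarith)
          _ = 2⁻¹ ^ ((p - 2) / 2) * ‖a‖ ^ ((p - 2) / 2) := Real.mul_rpow (by norm_num) h0.le
          _ ≤ _ := by
              refine mul_le_mul_of_nonneg_right ?_ (by positivity)
              rw [Real.inv_rpow (by norm_num), ← Real.rpow_neg (by norm_num)]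
              calc (2 : ℝ) ^ (-((p - 2) / 2)) ≤ 2 ^ (1 : ℝ) :=
                    Real.rpow_le_rpow_of_exponent_le (by norm_num) (by linarith)
                _ = 2 := Real.rpow_one 2
      generalize ‖a‖ ^ ((p - 2) / 2) = α at *
      generalize ‖b‖ ^ ((p - 2) / 2) = β at *
      generalize ‖a‖ = r at *
      generalize ‖b‖ = s at *
      have t1 : α * r - β * s ≤ α * (r - s) := by nlinarith
      have t2 : (α * r - β * s) ^ 2 ≤ (α * (r - s)) ^ 2 :=
        pow_le_pow_left₀ (by linarith) t1 2
      have t3 : α * β * ω ≤ 2 * (α ^ 2 * ω) := by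
        have : α * β * ω ≤ α * (2 * α) * ω := by gcongr
        linarith
      have t4 : 0 ≤ α ^ 2 * (r - s) ^ 2 := by positivity
      have t5 : 0 ≤ α ^ 2 * ω := by positivity
      nlinarith [mul_nonneg (sq_nonneg p) t4, mul_nonneg (sq_nonneg p) t5]
    · generalize ‖a‖ ^ ((p - 2) / 2) = α at *
      generalize ‖b‖ ^ ((p - 2) / 2) = β at *
      generalize ‖a‖ = r at *
      generalize ‖b‖ = s at *
      have hβs : 0 ≤ β * s := by positivity
      have hαr : 0 < α * r := by positivity
      have t1 : α * β * ω ≤ α * β * (2 * (r * s)) := by gcongr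
      -- With `ω ≤ 2rs` the whole left side is at most `(αr + βs)²`, and `r ≤ 2(r - s)` in this
      -- case.
      have t2 : (α * r + β * s) ^ 2 ≤ (2 * (α * r)) ^ 2 :=
        pow_le_pow_left₀ (by linarith) (by linarith) 2
      have t3 : r ^ 2 ≤ 4 * (r - s) ^ 2 := by nlinarith
      have t3' := mul_le_mul_of_nonneg_left t3 (sq_nonneg α)
      have t4 : 0 ≤ α ^ 2 * (r - s) ^ 2 := by positivity
      have t5 : 0 ≤ α ^ 2 * ω := by positivity
      have t6 : (α * r - β * s) ^ 2 + 2 * (α * β) * ω ≤ 16 * (α ^ 2 * (r - s) ^ 2) := by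
        nlinarith
      nlinarith [mul_nonneg (sq_nonneg p) t4, mul_nonneg (sq_nonneg p) t5]

theorem le_sq_norm_natF_sub_of_norm_le (hp : 1 < p) {a b : Space d} (hab : ‖b‖ ≤ ‖a‖) :
    (1 / 2) ^ p / 9 * (‖a‖ ^ (p - 2) * ‖a - b‖ ^ 2) ≤ ‖natF p a - natF p b‖ ^ 2 := by
  rcases (norm_nonneg a).eq_or_lt with h0 | h0
  · have ha : a = 0 := norm_eq_zero.1 h0.symm
    have hb : b = 0 := norm_eq_zero.1 (le_antisymm (h0.symm ▸ hab) (norm_nonneg b))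
    simp [ha, hb]
  rw [sq_norm_natF_sub, sq_norm_sub_eq]
  have hω1 : 0 ≤ ‖a‖ * ‖b‖ - inner ℝ a b := sub_nonneg.2 (real_inner_le_norm a b)
  have hω2 : ‖a‖ * ‖b‖ - inner ℝ a b ≤ 2 * (‖a‖ * ‖b‖) := by
    linarith [(abs_le.1 (abs_real_inner_le_norm a b)).1]
  have eα : ‖a‖ ^ (p - 2) = (‖a‖ ^ ((p - 2) / 2)) ^ 2 := by
    rw [← Real.rpow_natCast, ← Real.rpow_mul h0.le]; congr 1; push_cast; ring
  have ea := rpow_eq_rpow_sub_one_mul (q := p / 2) (by linarith) (norm_nonneg a)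
  have eb := rpow_eq_rpow_sub_one_mul (q := p / 2) (by linarith) (norm_nonneg b)
  have ek : p / 2 - 1 = (p - 2) / 2 := by ring
  rw [ek] at ea eb
  rw [eα]
  have hs := norm_nonneg b
  have hα : 0 < ‖a‖ ^ ((p - 2) / 2) := by positivity
  have hβ : 0 ≤ ‖b‖ ^ ((p - 2) / 2) := by positivity
  generalize hωd : ‖a‖ * ‖b‖ - inner ℝ a b = ω at *
  have hk0 : (0 : ℝ) ≤ (1 / 2) ^ p := by positivity
  have hk1 : (1 / 2 : ℝ) ^ p ≤ 1 / 2 := by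
    calc (1 / 2 : ℝ) ^ p ≤ (1 / 2) ^ (1 : ℝ) :=
          Real.rpow_le_rpow_of_exponent_ge (by norm_num) (by norm_num) hp.le
      _ = 1 / 2 := Real.rpow_one _
  rcases le_total 2 p with h2 | h2
  · have hβα : ‖b‖ ^ ((p - 2) / 2) ≤ ‖a‖ ^ ((p - 2) / 2) := Real.rpow_le_rpow hs hab (by linarith)
    have t2 : (‖a‖ ^ ((p - 2) / 2) * (‖a‖ - ‖b‖)) ^ 2 ≤
        (‖a‖ ^ ((p - 2) / 2) * ‖a‖ - ‖b‖ ^ ((p - 2) / 2) * ‖b‖) ^ 2 :=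
      pow_le_pow_left₀ (mul_nonneg hα.le (by linarith)) (by nlinarith) 2
    rcases le_total ‖a‖ (2 * ‖b‖) with hc | hc
    · have hβ2 : (1 / 2) ^ p * ‖a‖ ^ ((p - 2) / 2) ≤ ‖b‖ ^ ((p - 2) / 2) := by
        calc (1 / 2) ^ p * ‖a‖ ^ ((p - 2) / 2)
            ≤ 2⁻¹ ^ ((p - 2) / 2) * ‖a‖ ^ ((p - 2) / 2) := by
              refine mul_le_mul_of_nonneg_right ?_ (by positivity)
              rw [one_div]
              exact Real.rpow_le_rpow_of_exponent_ge (by norm_num) (by norm_num) (by linarith)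
          _ = (2⁻¹ * ‖a‖) ^ ((p - 2) / 2) := (Real.mul_rpow (by norm_num) h0.le).symm
          _ ≤ _ := Real.rpow_le_rpow (by positivity) (by linarith) (by linarith)
      generalize ‖a‖ ^ ((p - 2) / 2) = α at *
      generalize ‖b‖ ^ ((p - 2) / 2) = β at *
      generalize ‖a‖ = r at *
      generalize ‖b‖ = s at *
      generalize (1 / 2 : ℝ) ^ p = k at *
      have t3 : α * (k * α) * ω ≤ α * β * ω := by gcongr
      have t4 : 0 ≤ α ^ 2 * (r - s) ^ 2 := by positivity
      have t5 : 0 ≤ α ^ 2 * ω := by positivity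
      nlinarith [mul_nonneg hk0 t4, mul_nonneg hk0 t5]
    · generalize ‖a‖ ^ ((p - 2) / 2) = α at *
      generalize ‖b‖ ^ ((p - 2) / 2) = β at *
      generalize ‖a‖ = r at *
      generalize ‖b‖ = s at *
      generalize (1 / 2 : ℝ) ^ p = k at *
      -- For `2s ≤ r` the radial part alone dominates, since `2ω ≤ 4rs ≤ 8(r - s)²`; this is the
      -- origin of the `9`.
      have t3 : (r - s) ^ 2 + 2 * ω ≤ 9 * (r - s) ^ 2 := by nlinarith
      have t4 := mul_le_mul_of_nonneg_left t3 (sq_nonneg α)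
      have t5 : 0 ≤ α * β * ω := by positivity
      have t6 : 0 ≤ α ^ 2 * ((r - s) ^ 2 + 2 * ω) := by positivity
      nlinarith
  · have t := rpow_le_tangent (q := p / 2) (x := ‖a‖) (y := ‖b‖) (by linarith) (by linarith) h0 hs
    rw [ek, ea, eb] at t
    have hβα : ‖a‖ ^ ((p - 2) / 2) * (‖a‖ ^ ((p - 2) / 2) * (‖a‖ * ‖b‖ - inner ℝ a b)) ≤
        ‖a‖ ^ ((p - 2) / 2) * (‖b‖ ^ ((p - 2) / 2) * (‖a‖ * ‖b‖ - inner ℝ a b)) := by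
      refine mul_le_mul_of_nonneg_left ?_ hα.le
      -- At `b = 0` the negative power is `0` by convention and the comparison of powers fails, but
      -- the angular defect vanishes too.
      rcases hs.eq_or_lt with h | h
      · have hb : b = 0 := norm_eq_zero.1 h.symm
        simp [hb]
      · refine mul_le_mul_of_nonneg_right ?_ (by rw [hωd]; exact hω1)
        exact Real.rpow_le_rpow_of_nonpos h hab (by linarith)
    rw [hωd] at hβα
    generalize ‖a‖ ^ ((p - 2) / 2) = α at *
    generalize ‖b‖ ^ ((p - 2) / 2) = β at *
    generalize ‖a‖ = r at *
    generalize ‖b‖ = s at *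
    generalize (1 / 2 : ℝ) ^ p = k at *
    have h3 : 0 ≤ α * (r - s) := mul_nonneg hα.le (by linarith)
    have t1 : 1 / 2 * (α * (r - s)) ≤ α * r - β * s := by nlinarith
    have t2 : (1 / 2 * (α * (r - s))) ^ 2 ≤ (α * r - β * s) ^ 2 :=
      pow_le_pow_left₀ (by linarith) t1 2
    have t4 : 0 ≤ α ^ 2 * (r - s) ^ 2 := by positivity
    have t5 : 0 ≤ α ^ 2 * ω := by positivity
    nlinarith [mul_nonneg hk0 t4, mul_nonneg hk0 t5]

theorem sq_norm_natF_sub_le (hp : 1 < p) (a b : Space d) :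
    ‖natF p a - natF p b‖ ^ 2 ≤ (16 + p ^ 2) * (max ‖a‖ ‖b‖ ^ (p - 2) * ‖a - b‖ ^ 2) := by
  rcases le_total ‖b‖ ‖a‖ with h | h
  · rw [max_eq_left h]; exact sq_norm_natF_sub_le_of_norm_le hp h
  · rw [max_eq_right h, norm_sub_rev, norm_sub_rev a]; exact sq_norm_natF_sub_le_of_norm_le hp h

theorem le_sq_norm_natF_sub (hp : 1 < p) (a b : Space d) :
    (1 / 2) ^ p / 9 * (max ‖a‖ ‖b‖ ^ (p - 2) * ‖a - b‖ ^ 2) ≤ ‖natF p a - natF p b‖ ^ 2 := by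
  rcases le_total ‖b‖ ‖a‖ with h | h
  · rw [max_eq_left h]; exact le_sq_norm_natF_sub_of_norm_le hp h
  · rw [max_eq_right h, norm_sub_rev, norm_sub_rev (natF p a)]
    exact le_sq_norm_natF_sub_of_norm_le hp h

/-- The constant in `sq_norm_natF_sub_le_second_diff`. -/
def lowerConst (p : ℝ) : ℝ := 4 * (16 + p ^ 2) * 3 ^ p / convexityConst p

/-- The constant in `second_diff_le_sq_norm_natF_sub`. -/
def upperConst (p : ℝ) : ℝ := (8 + 2 * p ^ 2) * 3 ^ p * (9 * 2 ^ p)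

theorem lowerConst_pos (hp : 1 < p) : 0 < lowerConst p := by
  have := convexityConst_pos hp
  unfold lowerConst
  positivity

theorem upperConst_pos (p : ℝ) : 0 < upperConst p := by
  unfold upperConst
  positivity

theorem continuous_const_rpow_real {b : ℝ} (hb : b ≠ 0) : Continuous fun p : ℝ => b ^ p :=
  continuous_const.rpow continuous_id fun _ => Or.inl hb

theorem continuousOn_lowerConst : ContinuousOn lowerConst (Set.Ioi 1) := by
  have h3 := continuous_const_rpow_real (b := 3) (by norm_num)
  unfold lowerConst
  refine ContinuousOn.div (by fun_prop) continuous_convexityConst.continuousOn ?_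
  exact fun p hp => (convexityConst_pos hp).ne'

theorem continuous_upperConst : Continuous upperConst := by
  have h3 := continuous_const_rpow_real (b := 3) (by norm_num)
  have h2 := continuous_const_rpow_real (b := 2) (by norm_num)
  unfold upperConst
  fun_prop

/-- Pointwise uniform convexity: `max ‖b + h‖ ‖b - h‖` lies between `(‖b‖ + ‖h‖) / 2` and `‖b‖ +
‖h‖`, so both sides compare with the same quantity. The `4` in `lowerConst` comes from the
difference `2h`. -/
theorem sq_norm_natF_sub_le_second_diff (hp : 1 < p) (b h : Space d) :
    ‖natF p (b + h) - natF p (b - h)‖ ^ 2 ≤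
      lowerConst p * (‖b + h‖ ^ p + ‖b - h‖ ^ p - 2 * ‖b‖ ^ p) := by
  rcases eq_or_ne h 0 with rfl | hh
  · simp; linarith
  have hη : 0 < ‖h‖ := norm_pos_iff.2 hh
  have t1 := sq_norm_natF_sub_le hp (b + h) (b - h)
  have t2 := le_second_diff hp b h
  have e : (b + h) - (b - h) = (2 : ℝ) • h := by rw [two_smul]; abel
  rw [e, norm_smul, Real.norm_two] at t1
  have n1 : ‖b‖ ≤ max ‖b + h‖ ‖b - h‖ := by
    have : (2 : ℝ) • b = (b + h) + (b - h) := by rw [two_smul]; abel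
    have h3 := norm_add_le (b + h) (b - h)
    rw [← this, norm_smul, Real.norm_two] at h3
    linarith [le_max_left ‖b + h‖ ‖b - h‖, le_max_right ‖b + h‖ ‖b - h‖]
  have n2 : ‖h‖ ≤ max ‖b + h‖ ‖b - h‖ := by
    have h3 := norm_sub_le (b + h) (b - h)
    rw [e, norm_smul, Real.norm_two] at h3
    linarith [le_max_left ‖b + h‖ ‖b - h‖, le_max_right ‖b + h‖ ‖b - h‖]
  have n3 : max ‖b + h‖ ‖b - h‖ ≤ ‖b‖ + ‖h‖ := max_le (norm_add_le _ _) (norm_sub_le _ _)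
  have t3 := rpow_sub_two_le_of_comparable hp (x := max ‖b + h‖ ‖b - h‖) (y := ‖b‖ + ‖h‖)
    (by linarith) (by linarith [norm_nonneg b]) (by linarith)
  have hc := convexityConst_pos hp
  have t4 : ‖natF p (b + h) - natF p (b - h)‖ ^ 2 ≤
      4 * (16 + p ^ 2) * 3 ^ p * ((‖b‖ + ‖h‖) ^ (p - 2) * ‖h‖ ^ 2) := by
    refine t1.trans ?_
    calc _ ≤ (16 + p ^ 2) * ((3 ^ p * (‖b‖ + ‖h‖) ^ (p - 2)) * (2 * ‖h‖) ^ 2) := by gcongr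
      _ = _ := by ring
  calc _ ≤ _ := t4
    _ = lowerConst p * (convexityConst p * ((‖b‖ + ‖h‖) ^ (p - 2) * ‖h‖ ^ 2)) := by
      unfold lowerConst; field_simp
    _ ≤ _ := mul_le_mul_of_nonneg_left t2 (lowerConst_pos hp).le

/-- Pointwise uniform smoothness, measured from the base point `b` itself. Here only `‖b‖ + ‖h‖ ≤ 3
* max ‖b + h‖ ‖b‖` is available, which dictates the comparability factor `3`. -/
theorem second_diff_le_sq_norm_natF_sub (hp : 1 < p) (b h : Space d) :
    ‖b + h‖ ^ p + ‖b - h‖ ^ p - 2 * ‖b‖ ^ p ≤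
      upperConst p * ‖natF p (b + h) - natF p b‖ ^ 2 := by
  rcases eq_or_ne h 0 with rfl | hh
  · simp; linarith
  have hη : 0 < ‖h‖ := norm_pos_iff.2 hh
  have t1 := second_diff_le hp b h
  have t2 := le_sq_norm_natF_sub hp (b + h) b
  rw [add_sub_cancel_left] at t2
  have n2 : ‖h‖ ≤ ‖b + h‖ + ‖b‖ := by
    have h3 := norm_sub_le (b + h) b
    rwa [add_sub_cancel_left] at h3
  have m1 := le_max_left ‖b + h‖ ‖b‖
  have m2 := le_max_right ‖b + h‖ ‖b‖
  have n3 : max ‖b + h‖ ‖b‖ ≤ ‖b‖ + ‖h‖ :=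
    max_le (norm_add_le _ _) (by linarith)
  have hb := norm_nonneg b
  have t3 := rpow_sub_two_le_of_comparable hp (x := ‖b‖ + ‖h‖) (y := max ‖b + h‖ ‖b‖)
    (by positivity) (by linarith) (by linarith)
  have e2 : (1 / 2 : ℝ) ^ p * 2 ^ p = 1 := by
    rw [← Real.mul_rpow (by norm_num) (by norm_num)]; norm_num
  have hu : 0 ≤ upperConst p := (upperConst_pos p).le
  calc _ ≤ _ := t1
    _ ≤ (8 + 2 * p ^ 2) * ((3 ^ p * max ‖b + h‖ ‖b‖ ^ (p - 2)) * ‖h‖ ^ 2) := by gcongr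
    _ = upperConst p * ((1 / 2) ^ p / 9 * (max ‖b + h‖ ‖b‖ ^ (p - 2) * ‖h‖ ^ 2)) := by
      unfold upperConst
      linear_combination (-(8 + 2 * p ^ 2) * 3 ^ p * max ‖b + h‖ ‖b‖ ^ (p - 2) * ‖h‖ ^ 2) * e2
    _ ≤ _ := mul_le_mul_of_nonneg_left t2 hu

/-- `|a - b| ^ p` is controlled by the natural distance up to an arbitrarily small error. -/
theorem exists_rpow_norm_sub_le (hp : 1 < p) (ε : ℝ) (hε : 0 < ε) :
    ∃ C : ℝ, 0 < C ∧ ∀ a b : Space d,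
      ‖a - b‖ ^ p ≤ C * ‖natF p a - natF p b‖ ^ 2 + ε * (‖a‖ ^ p + ‖b‖ ^ p) := by
  have hp0 : 0 < p := by linarith
  set η := ε ^ p⁻¹ with hη
  have hη0 : 0 < η := by positivity
  have hηp : η ^ p = ε := by rw [hη, ← Real.rpow_mul hε.le, inv_mul_cancel₀ hp0.ne', Real.rpow_one]
  have hk : (0 : ℝ) < (1 / 2) ^ p / 9 := by positivity
  set k : ℝ := (1 / 2) ^ p / 9
  refine ⟨2 ^ p / (k * η ^ 2), by positivity, fun a b => ?_⟩
  have t := le_sq_norm_natF_sub hp a b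
  have hN : 0 ≤ 2 ^ p / (k * η ^ 2) * ‖natF p a - natF p b‖ ^ 2 := by positivity
  have hr : max ‖a‖ ‖b‖ ^ p ≤ ‖a‖ ^ p + ‖b‖ ^ p := by
    have ha : 0 ≤ ‖a‖ ^ p := by positivity
    have hb : 0 ≤ ‖b‖ ^ p := by positivity
    rcases max_choice ‖a‖ ‖b‖ with h | h <;> rw [h] <;> linarith
  have hr0 : 0 ≤ max ‖a‖ ‖b‖ := le_max_of_le_left (norm_nonneg a)
  have ht2 : ‖a - b‖ ≤ 2 * max ‖a‖ ‖b‖ := by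
    linarith [norm_sub_le a b, le_max_left ‖a‖ ‖b‖, le_max_right ‖a‖ ‖b‖]
  -- Relatively small differences go into the `ε` term, as `η ^ p = ε`. Otherwise `‖a - b‖` and the
  -- maximum are comparable, and the natural distance controls both. For `p < 2` the error term
  -- cannot be dropped.
  rcases le_total ‖a - b‖ (η * max ‖a‖ ‖b‖) with h | h
  · calc ‖a - b‖ ^ p ≤ (η * max ‖a‖ ‖b‖) ^ p := Real.rpow_le_rpow (norm_nonneg _) h hp0.le
      _ = ε * max ‖a‖ ‖b‖ ^ p := by rw [Real.mul_rpow hη0.le hr0, hηp]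
      _ ≤ ε * (‖a‖ ^ p + ‖b‖ ^ p) := by gcongr
      _ ≤ _ := by linarith
  · have h5 : 0 ≤ ε * (‖a‖ ^ p + ‖b‖ ^ p) := by positivity
    have h6 : k * η ^ 2 * max ‖a‖ ‖b‖ ^ p ≤ ‖natF p a - natF p b‖ ^ 2 := by
      refine le_trans ?_ t
      rw [rpow_eq_rpow_sub_two_mul hp0 hr0]
      calc _ = k * (max ‖a‖ ‖b‖ ^ (p - 2) * (η * max ‖a‖ ‖b‖) ^ 2) := by ring
        _ ≤ _ := by gcongr
    have h7 : ‖a - b‖ ^ p ≤ 2 ^ p * max ‖a‖ ‖b‖ ^ p := by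
      rw [← Real.mul_rpow (by norm_num) hr0]
      exact Real.rpow_le_rpow (norm_nonneg _) ht2 hp0.le
    have h8 : 2 ^ p * max ‖a‖ ‖b‖ ^ p ≤ 2 ^ p / (k * η ^ 2) * ‖natF p a - natF p b‖ ^ 2 := by
      calc _ = 2 ^ p / (k * η ^ 2) * (k * η ^ 2 * max ‖a‖ ‖b‖ ^ p) := by field_simp
        _ ≤ _ := by gcongr
    linarith

end NatF

/-! ### The Sobolev space -/

namespace W1p

variable {d : ℕ} {Ω : Set (Space d)} {p : ℝ} [Fact (1 < p)]

theorem grad_add (v w : W1p Ω p) : grad (v + w) = grad v + grad w := rfl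

theorem grad_sub (v w : W1p Ω p) : grad (v - w) = grad v - grad w := rfl

theorem coeFn_grad_add (v w : W1p Ω p) :
    ∀ᵐ x ∂volume.restrict Ω, grad (v + w) x = grad v x + grad w x := by
  rw [grad_add]; exact Lp.coeFn_add _ _

theorem coeFn_grad_sub (v w : W1p Ω p) :
    ∀ᵐ x ∂volume.restrict Ω, grad (v - w) x = grad v x - grad w x := by
  rw [grad_sub]; exact Lp.coeFn_sub _ _

theorem continuous_grad : Continuous (grad : W1p Ω p → LpSpace (Space d) p Ω) :=
  (WithLp.prod_continuous_ofLp 1 _ _).snd.comp continuous_subtype_val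

theorem integrable_norm_grad_rpow (v : W1p Ω p) :
    Integrable (fun x => ‖grad v x‖ ^ p) (volume.restrict Ω) := by
  have hp0 : 0 < p := zero_lt_one.trans (Fact.out : 1 < p)
  have := (Lp.memLp (grad v)).integrable_norm_rpow (by simpa using hp0) ENNReal.ofReal_ne_top
  simpa [ENNReal.toReal_ofReal hp0.le] using this

theorem integral_norm_grad_rpow (v : W1p Ω p) :
    ∫ x in Ω, ‖grad v x‖ ^ p = ‖grad v‖ ^ p := by
  have hp0 : 0 < p := zero_lt_one.trans (Fact.out : 1 < p)
  rw [Lp.norm_def, (Lp.memLp (grad v)).eLpNorm_eq_integral_rpow_norm (by simpa using hp0)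
    ENNReal.ofReal_ne_top, ENNReal.toReal_ofReal hp0.le, ENNReal.toReal_ofReal (by positivity),
    ← Real.rpow_mul (by positivity), inv_mul_cancel₀ hp0.ne', Real.rpow_one]

end W1p

/-! ### Closedness and completeness of `W^{1,p}(Ω)` -/

section Pairing

variable {d : ℕ} {Ω : Set (Space d)} {p : ℝ} [Fact (1 < p)]

/-- Integration against a continuous function with compact support is continuous on `L^p(Ω)`. -/
theorem continuous_integral_mul_of_hasCompactSupport {ψ : Space d → ℝ} (hψ : Continuous ψ)
    (hψc : HasCompactSupport ψ) :
    Continuous fun u : LpSpace ℝ p Ω => ∫ x in Ω, u x * ψ x := by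
  have : ENNReal.HolderConjugate (ENNReal.ofReal p) (ENNReal.ofReal p).conjExponent :=
    ENNReal.HolderConjugate.conjExponent (Fact.out : 1 ≤ ENNReal.ofReal p)
  have hm : MemLp ψ (ENNReal.ofReal p).conjExponent (volume.restrict Ω) :=
    hψ.memLp_of_hasCompactSupport hψc
  have : Fact (1 ≤ (ENNReal.ofReal p).conjExponent) :=
    ⟨ENNReal.HolderConjugate.one_le _ (ENNReal.ofReal p)⟩
  refine (((ContinuousLinearMap.mul ℝ ℝ).lpPairing (volume.restrict Ω) (ENNReal.ofReal p)
    (ENNReal.ofReal p).conjExponent).flip hm.toLp).continuous.congr fun u => ?_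
  rw [ContinuousLinearMap.flip_apply, ContinuousLinearMap.lpPairing_eq_integral]
  refine integral_congr_ae ?_
  filter_upwards [hm.coeFn_toLp] with x hx
  rw [hx]; rfl

theorem continuous_integral_coord_mul_of_hasCompactSupport {ψ : Space d → ℝ} (hψ : Continuous ψ)
    (hψc : HasCompactSupport ψ) (i : Fin d) :
    Continuous fun g : LpSpace (Space d) p Ω => ∫ x in Ω, g x i * ψ x := by
  refine ((continuous_integral_mul_of_hasCompactSupport hψ hψc).comp
    ((EuclideanSpace.proj (𝕜 := ℝ) i).compLpL (ENNReal.ofReal p)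
      (volume.restrict Ω)).continuous).congr fun g => ?_
  refine integral_congr_ae ?_
  filter_upwards [(EuclideanSpace.proj (𝕜 := ℝ) i).coeFn_compLpL g] with x hx
  simp only [hx]; rfl

/-- Both sides of each weak-derivative identity are continuous in the `L^p` pair, so the space is an
intersection of closed sets. -/
theorem isClosed_W1p :
    IsClosed (W1p Ω p : Set (WithLp 1 (LpSpace ℝ p Ω × LpSpace (Space d) p Ω))) := by
  have e : (W1p Ω p : Set (WithLp 1 (LpSpace ℝ p Ω × LpSpace (Space d) p Ω))) =
      ⋂ (φ : Space d → ℝ) (_ : IsTestFunction Ω φ) (i : Fin d),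
        {v | ∫ x in Ω, v.fst x * partialDeriv i φ x = - ∫ x in Ω, v.snd x i * φ x} := by
    ext v
    simp only [Set.mem_iInter]
    rfl
  rw [e]
  refine isClosed_iInter fun φ => isClosed_iInter fun hφ => isClosed_iInter fun i => ?_
  have hc := WithLp.prod_continuous_ofLp 1 (LpSpace ℝ p Ω) (LpSpace (Space d) p Ω)
  exact isClosed_eq
    ((continuous_integral_mul_of_hasCompactSupport (hφ.continuous_partialDeriv i)
      (hφ.hasCompactSupport_partialDeriv i)).comp hc.fst)
    ((continuous_integral_coord_mul_of_hasCompactSupport hφ.contDiff.continuous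
      hφ.hasCompactSupport i).comp hc.snd).neg

instance completeSpace_W1p : CompleteSpace (W1p Ω p) := isClosed_W1p.completeSpace_coe

end Pairing

/-! ### The energy -/

section Energy

variable {d : ℕ} {Ω : Set (Space d)} {p : ℝ} [hp : Fact (1 < p)] (f : StrongDual ℝ (W1p Ω p))

theorem energy_eq (v : W1p Ω p) : energy f v = 1 / p * ‖W1p.grad v‖ ^ p - f v := by
  rw [energy, W1p.integral_norm_grad_rpow]

theorem continuous_energy : Continuous (energy f) := by
  have hp0 : 0 ≤ p := (zero_lt_one.trans hp.out).le
  simp_rw [funext (energy_eq f)]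
  exact (continuous_const.mul (W1p.continuous_grad.norm.rpow_const fun _ => Or.inr hp0)).sub
    f.continuous

theorem energy_second_diff (u h : W1p Ω p) :
    energy f (u + h) + energy f (u - h) - 2 * energy f u =
      1 / p * ∫ x in Ω, (‖W1p.grad (u + h) x‖ ^ p + ‖W1p.grad (u - h) x‖ ^ p -
        2 * ‖W1p.grad u x‖ ^ p) := by
  rw [integral_sub (f := fun x => ‖W1p.grad (u + h) x‖ ^ p + ‖W1p.grad (u - h) x‖ ^ p)
    ((W1p.integrable_norm_grad_rpow _).add (W1p.integrable_norm_grad_rpow _))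
    ((W1p.integrable_norm_grad_rpow _).const_mul 2),
    integral_add (W1p.integrable_norm_grad_rpow _) (W1p.integrable_norm_grad_rpow _),
    integral_const_mul]
  simp only [energy, map_add, map_sub]
  ring

theorem integrable_second_diff (u h : W1p Ω p) :
    Integrable (fun x => ‖W1p.grad (u + h) x‖ ^ p + ‖W1p.grad (u - h) x‖ ^ p -
      2 * ‖W1p.grad u x‖ ^ p) (volume.restrict Ω) :=
  ((W1p.integrable_norm_grad_rpow _).add (W1p.integrable_norm_grad_rpow _)).sub
    ((W1p.integrable_norm_grad_rpow _).const_mul 2)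

theorem rhoSq_nonneg (v w : W1p Ω p) : 0 ≤ rhoSq v w :=
  integral_nonneg fun _ => sq_nonneg _

/-- Uniform convexity of the energy with respect to the natural distance. -/
theorem rhoSq_add_sub_le (u h : W1p Ω p) :
    rhoSq (u + h) (u - h) ≤
      lowerConst p * p * (energy f (u + h) + energy f (u - h) - 2 * energy f u) := by
  have hp0 : 0 < p := zero_lt_one.trans hp.out
  rw [energy_second_diff, ← mul_assoc, mul_assoc (lowerConst p), mul_one_div_cancel hp0.ne',
    mul_one, ← integral_const_mul]
  refine integral_mono_ae (integrable_rhoSq _ _) ((integrable_second_diff u h).const_mul _) ?_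
  filter_upwards [W1p.coeFn_grad_add u h, W1p.coeFn_grad_sub u h] with x h1 h2
  rw [h1, h2]
  exact sq_norm_natF_sub_le_second_diff hp.out _ _

/-- Second difference at the midpoint, with half the difference as increment. -/
theorem rhoSq_le_energy (v w : W1p Ω p) :
    rhoSq v w ≤ lowerConst p * p *
      (energy f v + energy f w - 2 * energy f ((1 / 2 : ℝ) • (v + w))) := by
  have h := rhoSq_add_sub_le f ((1 / 2 : ℝ) • (v + w)) ((1 / 2 : ℝ) • (v - w))
  have e1 : (1 / 2 : ℝ) • (v + w) + (1 / 2 : ℝ) • (v - w) = v := by module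
  have e2 : (1 / 2 : ℝ) • (v + w) - (1 / 2 : ℝ) • (v - w) = w := by module
  rwa [e1, e2] at h

/-- Uniform smoothness of the energy with respect to the natural distance. -/
theorem energy_second_diff_le (u h : W1p Ω p) :
    energy f (u + h) + energy f (u - h) - 2 * energy f u ≤
      1 / p * (upperConst p * rhoSq (u + h) u) := by
  have hp0 : 0 < p := zero_lt_one.trans hp.out
  rw [energy_second_diff, rhoSq]
  refine mul_le_mul_of_nonneg_left ?_ (by positivity)
  rw [← integral_const_mul]
  refine integral_mono_ae (integrable_second_diff u h) ((integrable_rhoSq _ _).const_mul _) ?_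
  filter_upwards [W1p.coeFn_grad_add u h, W1p.coeFn_grad_sub u h] with x h1 h2
  rw [h1, h2]
  exact second_diff_le_sq_norm_natF_sub hp.out _ _

theorem exists_norm_grad_sub_rpow_le (ε : ℝ) (hε : 0 < ε) :
    ∃ C : ℝ, 0 < C ∧ ∀ v w : W1p Ω p, ‖W1p.grad (v - w)‖ ^ p ≤
      C * rhoSq v w + ε * (‖W1p.grad v‖ ^ p + ‖W1p.grad w‖ ^ p) := by
  obtain ⟨C, hC, h⟩ := exists_rpow_norm_sub_le (d := d) hp.out ε hε
  refine ⟨C, hC, fun v w => ?_⟩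
  have i1 := W1p.integrable_norm_grad_rpow v
  have i2 := W1p.integrable_norm_grad_rpow w
  have i12 : Integrable (fun x => ‖W1p.grad v x‖ ^ p + ‖W1p.grad w x‖ ^ p)
      (volume.restrict Ω) := i1.add i2
  rw [← W1p.integral_norm_grad_rpow, ← W1p.integral_norm_grad_rpow, ← W1p.integral_norm_grad_rpow,
    rhoSq, ← integral_add i1 i2, ← integral_const_mul, ← integral_const_mul,
    ← integral_add ((integrable_rhoSq v w).const_mul C) (i12.const_mul ε)]
  refine integral_mono_ae (W1p.integrable_norm_grad_rpow _)
    (((integrable_rhoSq v w).const_mul C).add (i12.const_mul ε)) ?_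
  filter_upwards [W1p.coeFn_grad_sub v w] with x hx
  rw [hx]
  exact h _ _

end Energy

/-! ### Existence and uniqueness of minimizers -/

/-- The tangent of `g^p / p` at the point `x` with `x^(p-1) = K + 1` keeps slope one after `K * g`
is subtracted. -/
theorem exists_add_le_rpow_sub {p : ℝ} (hp : 1 < p) {K : ℝ} (hK : 0 ≤ K) :
    ∃ L : ℝ, ∀ g : ℝ, 0 ≤ g → g + L ≤ 1 / p * g ^ p - K * g := by
  have hp0 : 0 < p := by linarith
  have hx : 0 ≤ (K + 1) ^ (p - 1)⁻¹ := by positivity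
  set x := (K + 1) ^ (p - 1)⁻¹ with hxd
  have e : x ^ (p - 1) = K + 1 := by
    rw [hxd, ← Real.rpow_mul (by positivity), inv_mul_cancel₀ (by linarith), Real.rpow_one]
  refine ⟨1 / p * x ^ p - (K + 1) * x, fun g hg => ?_⟩
  have h := mul_le_mul_of_nonneg_left (rpow_tangent_le hp.le hx hg) (by positivity : 0 ≤ 1 / p)
  rw [e] at h
  have e2 : 1 / p * (x ^ p + p * (K + 1) * (g - x)) = 1 / p * x ^ p + (K + 1) * (g - x) := by
    field_simp
  rw [e2] at h
  linarith

section Minimizer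

variable {d : ℕ} {Ω : Set (Space d)} {p : ℝ} [hp : Fact (1 < p)] {f : StrongDual ℝ (W1p Ω p)}
  {U : Submodule ℝ (W1p Ω p)}

theorem PoincareOn.exists_norm_le (hU : PoincareOn U) :
    ∃ c : ℝ, 0 < c ∧ ∀ v ∈ U, ‖v‖ ≤ c * ‖W1p.grad v‖ := by
  obtain ⟨cP, hcP, h⟩ := hU
  refine ⟨cP + 1, by positivity, fun v hv => ?_⟩
  rw [W1p.norm_eq]
  linarith [h v hv]

/-- The energy is coercive on subspaces with a Poincaré inequality. -/
theorem PoincareOn.exists_norm_grad_add_le_energy (hU : PoincareOn U)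
    (f : StrongDual ℝ (W1p Ω p)) :
    ∃ L : ℝ, ∀ v ∈ U, ‖W1p.grad v‖ + L ≤ energy f v := by
  obtain ⟨c, hc, h⟩ := hU.exists_norm_le
  obtain ⟨L, hL⟩ := exists_add_le_rpow_sub hp.out (K := ‖f‖ * c) (by positivity)
  refine ⟨L, fun v hv => (hL _ (norm_nonneg _)).trans ?_⟩
  rw [energy_eq]
  have h1 : f v ≤ ‖f‖ * ‖v‖ := (le_abs_self _).trans (f.le_opNorm v)
  have h2 : ‖f‖ * ‖v‖ ≤ ‖f‖ * (c * ‖W1p.grad v‖) := by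
    gcongr; exact h v hv
  linarith

/-- Almost minimizers of the energy are close to each other. -/
theorem PoincareOn.exists_dist_le (hU : PoincareOn U) {I : ℝ} (hI : ∀ w ∈ U, I ≤ energy f w)
    {ε : ℝ} (hε : 0 < ε) :
    ∃ δ : ℝ, 0 < δ ∧ ∀ v ∈ U, ∀ w ∈ U, energy f v ≤ I + δ → energy f w ≤ I + δ →
      dist v w ≤ ε := by
  have hp0 : 0 < p := zero_lt_one.trans hp.out
  obtain ⟨c, hc, hcU⟩ := hU.exists_norm_le
  obtain ⟨L, hL⟩ := hU.exists_norm_grad_add_le_energy f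
  -- By coercivity `R` bounds the gradient norm of every competitor with energy at most `I + 1`.
  -- Below, `η` is the target for `‖∇(v - w)‖ ^ p`; its two halves pay for the natural distance and
  -- for the error term.
  set R := |I + 1 - L| + 1 with hR
  have hR0 : 0 < R := by positivity
  have hRp : 0 < R ^ p := by positivity
  set η := (ε / c) ^ p with hη
  have hη0 : 0 < η := by positivity
  obtain ⟨C, hC, hCb⟩ := exists_norm_grad_sub_rpow_le (Ω := Ω) (p := p) (η / (4 * R ^ p))
    (by positivity)
  have hl := lowerConst_pos hp.out
  refine ⟨min 1 (η / (4 * (C * (lowerConst p * p)))), lt_min one_pos (by positivity),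
    fun v hv w hw h1 h2 => ?_⟩
  have hδ1 := min_le_left 1 (η / (4 * (C * (lowerConst p * p))))
  have hδ2 := min_le_right 1 (η / (4 * (C * (lowerConst p * p))))
  set δ := min 1 (η / (4 * (C * (lowerConst p * p))))
  have bound : ∀ z ∈ U, energy f z ≤ I + δ → ‖W1p.grad z‖ ^ p ≤ R ^ p := by
    intro z hz hze
    refine Real.rpow_le_rpow (norm_nonneg _) ?_ hp0.le
    linarith [hL z hz, le_abs_self (I + 1 - L)]
  -- The midpoint also has energy at least `I`, so the second difference is at most `2δ`.
  have hm := hI _ (U.smul_mem (1 / 2 : ℝ) (U.add_mem hv hw))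
  have hρ : rhoSq v w ≤ lowerConst p * p * (2 * δ) := by
    refine (rhoSq_le_energy f v w).trans ?_
    gcongr
    linarith
  have key : ‖W1p.grad (v - w)‖ ^ p ≤ η := by
    refine (hCb v w).trans ?_
    have k1 : C * rhoSq v w ≤ η / 2 := by
      calc C * rhoSq v w ≤ C * (lowerConst p * p * (2 * (η / (4 * (C * (lowerConst p * p)))))) := by
            gcongr
            exact hρ.trans (by gcongr)
        _ = η / 2 := by field_simp; norm_num
    have k2 : η / (4 * R ^ p) * (‖W1p.grad v‖ ^ p + ‖W1p.grad w‖ ^ p) ≤ η / 2 := by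
      calc _ ≤ η / (4 * R ^ p) * (R ^ p + R ^ p) := by
            refine mul_le_mul_of_nonneg_left ?_ (by positivity)
            exact add_le_add (bound v hv h1) (bound w hw h2)
        _ = η / 2 := by field_simp; norm_num
    linarith
  have key2 : ‖W1p.grad (v - w)‖ ≤ ε / c :=
    (Real.rpow_le_rpow_iff (norm_nonneg _) (by positivity) hp0).1 key
  rw [dist_eq_norm]
  calc ‖v - w‖ ≤ c * ‖W1p.grad (v - w)‖ := hcU _ (U.sub_mem hv hw)
    _ ≤ c * (ε / c) := by gcongr
    _ = ε := by field_simp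

theorem IsMinimizer.eq (hU : PoincareOn U) {u w : W1p Ω p} (hu : IsMinimizer f U u)
    (hw : IsMinimizer f U w) : u = w := by
  refine eq_of_forall_dist_le fun ε hε => ?_
  obtain ⟨δ, hδ, h⟩ := hU.exists_dist_le (I := energy f u) hu.2 hε
  exact h u hu.1 w hw.1 (by linarith) (by linarith [hw.2 u hu.1])

/-- A minimizing sequence is Cauchy by `PoincareOn.exists_dist_le`; its limit stays in the closed
subspace and is a minimizer by continuity of the energy. -/
theorem exists_isMinimizer (hUc : IsClosed (U : Set (W1p Ω p))) (hU : PoincareOn U) :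
    ∃ u, IsMinimizer f U u := by
  obtain ⟨L, hL⟩ := hU.exists_norm_grad_add_le_energy f
  have hbdd : BddBelow (energy f '' (U : Set (W1p Ω p))) := by
    refine ⟨L, ?_⟩
    rintro _ ⟨v, hv, rfl⟩
    linarith [hL v hv, norm_nonneg (W1p.grad v)]
  have hne : (energy f '' (U : Set (W1p Ω p))).Nonempty := ⟨_, 0, U.zero_mem, rfl⟩
  set I := sInf (energy f '' (U : Set (W1p Ω p)))
  have hI : ∀ w ∈ U, I ≤ energy f w := fun w hw => csInf_le hbdd ⟨w, hw, rfl⟩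
  have hex : ∀ n : ℕ, ∃ v ∈ U, energy f v < I + 1 / ((n : ℝ) + 1) := by
    intro n
    obtain ⟨_, ⟨v, hv, rfl⟩, h⟩ := exists_lt_of_csInf_lt hne
      (lt_add_of_pos_right I (Nat.one_div_pos_of_nat (n := n)))
    exact ⟨v, hv, h⟩
  choose v hvU hv using hex
  have hlim := tendsto_one_div_add_atTop_nhds_zero_nat (𝕜 := ℝ)
  have hcauchy : CauchySeq v := by
    rw [Metric.cauchySeq_iff']
    intro ε hε
    obtain ⟨δ, hδ, h⟩ := hU.exists_dist_le hI (half_pos hε)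
    obtain ⟨N, hN⟩ := (Filter.eventually_atTop).1 (hlim.eventually_lt_const hδ)
    refine ⟨N, fun n hn => ?_⟩
    have := h (v n) (hvU n) (v N) (hvU N) (by linarith [hv n, hN n hn])
      (by linarith [hv N, hN N le_rfl])
    linarith
  obtain ⟨u, hu⟩ := cauchySeq_tendsto_of_complete hcauchy
  refine ⟨u, hUc.mem_of_tendsto hu (Filter.Eventually.of_forall hvU), fun w hw => ?_⟩
  have h1 := ((continuous_energy f).tendsto u).comp hu
  have h2 : Filter.Tendsto (fun n : ℕ => I + 1 / ((n : ℝ) + 1)) Filter.atTop (nhds (I + 0)) :=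
    tendsto_const_nhds.add hlim
  have h3 := le_of_tendsto_of_tendsto' h1 h2 fun n => (hv n).le
  linarith [hI w hw]

/-! ### Energy gap versus natural distance, and Céa's lemma -/

theorem IsMinimizer.rhoSq_le {u : W1p Ω p} (hu : IsMinimizer f U u) {v : W1p Ω p} (hv : v ∈ U) :
    rhoSq v u ≤ lowerConst p * p * (energy f v - energy f u) := by
  have hp0 : 0 < p := zero_lt_one.trans hp.out
  have hl := lowerConst_pos hp.out
  refine (rhoSq_le_energy f v u).trans ?_
  have := hu.2 _ (U.smul_mem (1 / 2 : ℝ) (U.add_mem hv hu.1))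
  refine mul_le_mul_of_nonneg_left ?_ (by positivity)
  linarith

/-- The reflected point `2u - v` lies in the subspace and has energy at least that of `u`, so the
gap is at most the second difference at `u`. -/
theorem IsMinimizer.energy_sub_le {u : W1p Ω p} (hu : IsMinimizer f U u) {v : W1p Ω p}
    (hv : v ∈ U) : energy f v - energy f u ≤ 1 / p * (upperConst p * rhoSq v u) := by
  have h := energy_second_diff_le f u (v - u)
  rw [add_sub_cancel] at h
  have := hu.2 _ (U.sub_mem hu.1 (U.sub_mem hv hu.1))
  linarith

/-- Céa's lemma on a subset of the subspace. -/
theorem IsMinimizer.rhoSq_le_optError {u : W1p Ω p} (hu : IsMinimizer f U u)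
    {M : Set (W1p Ω p)} (hM : M ⊆ (U : Set (W1p Ω p))) {v : W1p Ω p} (hv : v ∈ M) :
    rhoSq v u ≤ lowerConst p * (p + upperConst p) *
      (optError f M v + ⨅ w : M, rhoSq (w : W1p Ω p) u) := by
  have hp0 : 0 < p := zero_lt_one.trans hp.out
  have hl := lowerConst_pos hp.out
  have hupper := upperConst_pos p
  have : Nonempty M := ⟨⟨v, hv⟩⟩
  have hbE : BddBelow (Set.range fun w : M => energy f (w : W1p Ω p)) := by
    refine ⟨energy f u, ?_⟩
    rintro _ ⟨w, rfl⟩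
    exact hu.2 _ (hM w.2)
  have hδ : 0 ≤ optError f M v := sub_nonneg.2 (ciInf_le hbE ⟨v, hv⟩)
  have hr : 0 ≤ ⨅ w : M, rhoSq (w : W1p Ω p) u := le_ciInf fun w => rhoSq_nonneg _ _
  have hinf : (⨅ w : M, energy f (w : W1p Ω p)) - energy f u ≤
      1 / p * upperConst p * ⨅ w : M, rhoSq (w : W1p Ω p) u := by
    rw [Real.mul_iInf_of_nonneg (by positivity)]
    refine le_ciInf fun w => ?_
    rw [mul_assoc]
    exact (sub_le_sub_right (ciInf_le hbE w) _).trans (hu.energy_sub_le (hM w.2))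
  calc rhoSq v u ≤ lowerConst p * p * (energy f v - energy f u) := hu.rhoSq_le (hM hv)
    _ ≤ lowerConst p * p *
        (optError f M v + 1 / p * upperConst p * ⨅ w : M, rhoSq (w : W1p Ω p) u) := by
      gcongr
      unfold optError
      linarith
    _ = lowerConst p * (p * optError f M v +
        upperConst p * ⨅ w : M, rhoSq (w : W1p Ω p) u) := by field_simp
    -- Both weights `p` and `upperConst p` are enlarged to their sum, as the optimization error and
    -- the infimum are nonnegative.
    _ ≤ lowerConst p * ((p + upperConst p) *
        (optError f M v + ⨅ w : M, rhoSq (w : W1p Ω p) u)) := by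
      gcongr
      nlinarith [mul_nonneg hp0.le hr, mul_nonneg hupper.le hδ]
    _ = _ := by ring

end Minimizer

end PDirichlet

end

open PDirichlet in
theorem mainTheorem2 (d : ℕ) :
    ∃ c : ℝ → ℝ, ContinuousOn c (Set.Ioi 1) ∧ (∀ p ∈ Set.Ioi (1 : ℝ), 0 < c p) ∧
      ∀ (p : ℝ) [Fact (1 < p)] (Ω : Set (Space d)),
        IsOpen Ω → IsConnected Ω → Bornology.IsBounded Ω →
        ∀ (f : StrongDual ℝ (W1p Ω p)) (U : Submodule ℝ (W1p Ω p)),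
          IsClosed (U : Set (W1p Ω p)) → PoincareOn U →
          (∃! u : W1p Ω p, IsMinimizer f U u) ∧
          ∀ uStar : W1p Ω p, IsMinimizer f U uStar →
            ∀ M : Set (W1p Ω p), M ⊆ (U : Set (W1p Ω p)) → ∀ v ∈ M,
              rhoSq v uStar ≤ c p * (optError f M v + ⨅ w : M, rhoSq (w : W1p Ω p) uStar) := by
  -- Continuity is claimed only for `p > 1`: `lowerConst` divides by `convexityConst`, which
  -- vanishes at `p = 1`.
  refine ⟨fun p => lowerConst p * (p + upperConst p), ?_, ?_, ?_⟩
  · exact continuousOn_lowerConst.mul (continuous_id.add continuous_upperConst).continuousOn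
  · intro p hp
    have hp1 : 1 < p := hp
    have := lowerConst_pos hp1
    have := upperConst_pos p
    have : 0 < p := by linarith
    positivity
  · intro p _ Ω _ _ _ f U hUc hU
    obtain ⟨u, hu⟩ := exists_isMinimizer (f := f) hUc hU
    exact ⟨⟨u, hu, fun w hw => hw.eq hU hu⟩,
      fun uStar huStar M hM v hv => huStar.rhoSq_le_optError hM hv⟩
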